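/- Let $X$ be a connected scheme, let $G$ be a finite group acting on $X$ (on the left), and let $x:\operatorname{Spec}\Omega\to X$ be a geometric point of $X$, $\Omega$ being a separably closed field. Let $\mathrm{FEt}(X)$ be the category of finite étale coverings $Y\to X$, and let $F_x:\mathrm{FEt}(X)\to\{\text{finite sets}\}$ be the fibre functor sending $Y\to X$ to the set of morphisms $\operatorname{Spec}\Omega\to Y$ lifting $x$; let $\widehat\pi_1(X,x)=\operatorname{Aut}(F_x)$, with its profinite topology. Let $\mathrm{FEt}_G(X)$ be the category of $G$-equivariant finite étale coverings of $X$, that is, of schemes $Y$ with an action of $G$ and a $G$-equivariant finite étale morphism $Y\to X$, with the $G$-equivariant $X$-morphisms; it is the category of finite étale coverings of the quotient stack $[X/G]$. Let $\widehat\pi_1([X/G],x)$ be the automorphism group, with its profinite topology, of the composite of the forgetful functor $\mathrm{FEt}_G(X)\to\mathrm{FEt}(X)$ with $F_x$. Then there is a short exact sequence of profinite groups, with continuous homomorphisms, $$1\longrightarrow\widehat\pi_1(X,x)\overset{i}{\longrightarrow}\widehat\pi_1([X/G],x)\overset{p}{\longrightarrow}G\longrightarrow 1.$$ Here $i$ is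 induced by the projection $X\to[X/G]$, that is, by the forgetful functor $\mathrm{FEt}_G(X)\to\mathrm{FEt}(X)$, and $p$ is given by the action on the fibre over $x$ of the equivariant covering $G\times X\to X$, $(g,y)\mapsto y$, where $h\in G$ acts on $G\times X$ by $h\cdot(g,y)=(hg,h\cdot y)$: for $\gamma\in\widehat\pi_1([X/G],x)$ and $g\in G$ one has $\gamma\cdot(g,x)=(p(\gamma)g,x)$. -/

import Mathlib

open CategoryTheory CategoryTheory.Limits AlgebraicGeometry

universe u v

namespace QuotientStack

noncomputable section

/-- A morphism of schemes is a finite étale covering if it is finite and étale. -/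
def finiteEtale : MorphismProperty Scheme.{u} :=
  fun _ _ f => IsFinite f ∧ Etale f

/-- The category of finite étale coverings of the scheme `X`; morphisms are the morphisms of
schemes over `X`. -/
abbrev FEt (X : Scheme.{u}) : Type (u + 1) :=
  finiteEtale.Over ⊤ X

/-- The category of `G`-equivariant finite étale coverings of a scheme `X` with an action of `G`:
schemes `Y` with an action of `G` and a `G`-equivariant finite étale morphism `Y ⟶ X`; morphisms
are the `G`-equivariant morphisms over `X`.  This is the category of finite étale coverings of the
quotient stack `[X/G]`. -/
abbrev EquivariantFEt {G : Type v} [Group G] (X : Action Scheme.{u} G) : Type _ :=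
  (finiteEtale.inverseImage (Action.forget Scheme.{u} G)).Over ⊤ X

/-- Forgetting the action of `G`. In terms of stacks: pulling back finite étale coverings along
the projection `X ⟶ [X/G]`. -/
def forgetAction {G : Type v} [Group G] (X : Action Scheme.{u} G) :
    EquivariantFEt X ⥤ FEt X.V where
  obj Y := MorphismProperty.Over.mk ⊤ Y.hom.hom Y.prop
  map f := MorphismProperty.Over.homMk f.left.hom
    (congrArg Action.Hom.hom (MorphismProperty.Over.w f)) trivial

/-- A finite scheme over a field has only finitely many rational points. -/
theorem finite_sections {Ω : Type u} [Field Ω] {Z : Scheme.{u}}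
    (f : Z ⟶ Spec (.of Ω)) [IsFinite f] :
    Finite {s : Spec (.of Ω) ⟶ Z // s ≫ f = 𝟙 _} := by
  have : IsAffine Z := isAffine_of_isAffineHom f
  obtain ⟨φ, hφ⟩ := Spec.map_surjective (Z.isoSpec.inv ≫ f)
  have hfin : IsFinite (Spec.map φ) := by rw [hφ]; infer_instance
  rw [IsFinite.SpecMap_iff] at hfin
  algebraize [φ.hom]
  refine Finite.of_injective (β := Γ(Z, ⊤) →ₐ[Ω] Ω) (fun s =>
    { (Spec.preimage (s.1 ≫ Z.isoSpec.hom)).hom with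
      commutes' := fun a => ?_ }) ?_
  · have h : φ ≫ Spec.preimage (s.1 ≫ Z.isoSpec.hom) = 𝟙 _ := by
      apply Spec.map_injective
      rw [Spec.map_comp, Spec.map_preimage, hφ, Category.assoc, Iso.hom_inv_id_assoc, s.2,
        Spec.map_id]
    exact congrArg (fun ψ => ψ.hom a) h
  · intro s t h
    have h2 : Spec.preimage (s.1 ≫ Z.isoSpec.hom) = Spec.preimage (t.1 ≫ Z.isoSpec.hom) := by
      ext a
      exact DFunLike.congr_fun h a
    have h3 := congrArg Spec.map h2
    rw [Spec.map_preimage, Spec.map_preimage, cancel_mono] at h3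
    exact Subtype.ext h3

/-- The set of geometric points of `Y` above the geometric point `x` of `X`. -/
abbrev GeomFibre {X Y : Scheme.{u}} (f : Y ⟶ X) {Ω : Type u} [Field Ω]
    (x : Spec (.of Ω) ⟶ X) : Type u :=
  {y : Spec (.of Ω) ⟶ Y // y ≫ f = x}

theorem finite_geomFibre {X Y : Scheme.{u}} (f : Y ⟶ X) [IsFinite f] {Ω : Type u} [Field Ω]
    (x : Spec (.of Ω) ⟶ X) : Finite (GeomFibre f x) := by
  have := finite_sections (pullback.snd f x)
  refine Finite.of_injective
    (β := {s : Spec (.of Ω) ⟶ pullback f x // s ≫ pullback.snd f x = 𝟙 _})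
    (fun y => ⟨pullback.lift y.1 (𝟙 _) (y.2.trans (Category.id_comp x).symm),
      pullback.lift_snd _ _ _⟩) ?_
  intro y z h
  have h2 := congrArg (fun s => s.1 ≫ pullback.fst f x) h
  exact Subtype.ext ((pullback.lift_fst _ _ _).symm.trans (h2.trans (pullback.lift_fst _ _ _)))

/-- The fibre functor of the category of finite étale coverings of `X` at the geometric point `x`:
it sends `Y ⟶ X` to the finite set of geometric points of `Y` above `x`. -/
def fibreFunctor {X : Scheme.{u}} {Ω : Type u} [Field Ω] (x : Spec (.of Ω) ⟶ X) :
    FEt X ⥤ FintypeCat.{u} where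
  obj Y :=
    have : IsFinite Y.hom := Y.prop.1
    have : Finite (GeomFibre Y.hom x) := finite_geomFibre Y.hom x
    FintypeCat.of (GeomFibre Y.hom x)
  map f := FintypeCat.homMk fun y => ⟨y.1 ≫ f.left, by
    rw [Category.assoc, MorphismProperty.Over.w]; exact y.2⟩

/-- The profinite fundamental group of the scheme `X` at the geometric point `x`: the group of
automorphisms of the fibre functor, with the topology induced by the product of the
discrete finite groups `Aut (F Y)`. -/
abbrev pi1 {X : Scheme.{u}} {Ω : Type u} [Field Ω] (x : Spec (.of Ω) ⟶ X) : Type _ :=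
  Aut (fibreFunctor x)

/-- The fibre functor, at the image of the geometric point `x` of `X`, of the category of finite
étale coverings of the quotient stack `[X/G]`. -/
abbrev quotientFibreFunctor {G : Type v} [Group G] (X : Action Scheme.{u} G)
    {Ω : Type u} [Field Ω] (x : Spec (.of Ω) ⟶ X.V) : EquivariantFEt X ⥤ FintypeCat.{u} :=
  forgetAction X ⋙ fibreFunctor x

/-- The profinite fundamental group of the quotient stack `[X/G]` at (the image of) the geometric
point `x` of `X`. -/
abbrev quotientPi1 {G : Type v} [Group G] (X : Action Scheme.{u} G)
    {Ω : Type u} [Field Ω] (x : Spec (.of Ω) ⟶ X.V) : Type _ :=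
  Aut (quotientFibreFunctor X x)

/-- The homomorphism of fundamental groups induced by the projection `X ⟶ [X/G]`: an automorphism
of the fibre functor of `X` acts on the fibre of an equivariant covering through the underlying
covering. -/
def projectionPi1 {G : Type v} [Group G] (X : Action Scheme.{u} G)
    {Ω : Type u} [Field Ω] (x : Spec (.of Ω) ⟶ X.V) : pi1 x →* quotientPi1 X x :=
  Functor.mapAut (fibreFunctor x) ((Functor.whiskeringLeft _ _ _).obj (forgetAction X))

theorem isFinite_of_iso {X Y : Scheme.{u}} (r : X ≅ Y) : IsFinite r.hom :=
  inferInstance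

theorem isFinite_sigmaDesc_id {ι : Type v} [Finite ι] (X : Scheme.{u}) :
    ∀ [HasCoproduct fun _ : ι => X], IsFinite (Sigma.desc fun _ : ι => 𝟙 X) := by
  induction ι using Finite.induction_empty_option with
  | @of_equiv α β e ih =>
    intro _
    have : HasCoproduct fun _ : α => X := hasCoproduct_of_equiv_of_iso (fun _ : β => X) _ e
      fun _ => Iso.refl _
    let r : (∐ fun _ : β => X) ≅ ∐ fun _ : α => X :=
      { hom := Sigma.desc fun b => Sigma.ι (fun _ : α => X) (e.symm b)
        inv := Sigma.desc fun a => Sigma.ι (fun _ : β => X) (e a)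
        hom_inv_id := Sigma.hom_ext _ _ fun b => by
          rw [Sigma.ι_desc_assoc, Sigma.ι_desc, Category.comp_id, e.apply_symm_apply]
        inv_hom_id := Sigma.hom_ext _ _ fun a => by
          rw [Sigma.ι_desc_assoc, Sigma.ι_desc, Category.comp_id, e.symm_apply_apply] }
    have h : Sigma.desc (fun _ : β => 𝟙 X) = r.hom ≫ Sigma.desc (fun _ : α => 𝟙 X) :=
      Sigma.hom_ext _ _ fun b => by
        rw [Sigma.ι_desc, Sigma.ι_desc_assoc, Sigma.ι_desc]
    rw [h]
    exact MorphismProperty.comp_mem @IsFinite _ _ (isFinite_of_iso r) ih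
  | h_empty =>
    intro _
    have : IsEmpty ↥(∐ fun _ : PEmpty => X) := isInitial_iff_isEmpty.1
      ⟨IsInitial.ofUniqueHom (fun _ => Sigma.desc fun a => a.elim)
        fun _ _ => Sigma.hom_ext _ _ fun a => a.elim⟩
    infer_instance
  | @h_option α _ ih =>
    intro _
    let r : (∐ fun _ : Option α => X) ≅ X ⨿ (∐ fun _ : α => X) :=
      { hom := Sigma.desc fun b => b.elim coprod.inl
          (fun a => Sigma.ι (fun _ : α => X) a ≫ coprod.inr)
        inv := coprod.desc (Sigma.ι (fun _ : Option α => X) none)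
          (Sigma.desc fun a => Sigma.ι (fun _ : Option α => X) (some a))
        hom_inv_id := Sigma.hom_ext _ _ fun b => by
          rw [Sigma.ι_desc_assoc, Category.comp_id]
          cases b with
          | none => exact coprod.inl_desc _ _
          | some a =>
            rw [Option.elim_some, Category.assoc, coprod.inr_desc, Sigma.ι_desc]
        inv_hom_id := by
          apply coprod.hom_ext
          · rw [coprod.inl_desc_assoc, Sigma.ι_desc, Category.comp_id, Option.elim_none]
          · refine Sigma.hom_ext _ _ fun a => ?_
            rw [coprod.inr_desc_assoc, Sigma.ι_desc_assoc, Sigma.ι_desc, Category.comp_id,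
              Option.elim_some] }
    have h : Sigma.desc (fun _ : Option α => 𝟙 X) =
        r.hom ≫ coprod.desc (𝟙 X) (Sigma.desc (fun _ : α => 𝟙 X)) :=
      Sigma.hom_ext _ _ fun b => by
        rw [Sigma.ι_desc, Sigma.ι_desc_assoc]
        cases b with
        | none => exact (coprod.inl_desc _ _).symm
        | some a => rw [Option.elim_some, Category.assoc, coprod.inr_desc, Sigma.ι_desc]
    rw [h]
    have h1 : IsFinite (Sigma.desc fun _ : α => 𝟙 X) := ih
    have h2 : IsFinite (𝟙 X) := inferInstance
    have h3 : IsFinite (coprod.desc (𝟙 X) (Sigma.desc fun _ : α => 𝟙 X)) := inferInstance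
    exact MorphismProperty.comp_mem @IsFinite _ _ (isFinite_of_iso r) h3

theorem etale_sigmaDesc_id {ι : Type v} [Finite ι] (X : Scheme.{u}) :
    Etale (Sigma.desc fun _ : ι => 𝟙 X) :=
  have : IsZariskiLocalAtSource @Etale.{u} :=
    HasRingHomProperty.instIsZariskiLocalAtSource (Q := RingHom.Etale)
  have h : Etale (𝟙 X) := inferInstance
  IsZariskiLocalAtSource.sigmaDesc (P := @Etale.{u}) fun _ => h

/-- A finite disjoint union of copies of `X` is finite étale over `X`. -/
theorem finiteEtale_sigmaDesc_id {ι : Type v} [Finite ι] (X : Scheme.{u}) :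
    finiteEtale (Sigma.desc fun _ : ι => 𝟙 X) :=
  ⟨isFinite_sigmaDesc_id X, etale_sigmaDesc_id X⟩

/-- The scheme `G × X = ∐_{g ∈ G} X` with the diagonal action `h • (g, x) = (h * g, h • x)`. -/
def torsorAction {G : Type v} [Group G] [Finite G] (X : Action Scheme.{u} G) :
    Action Scheme.{u} G where
  V := ∐ fun _ : G => X.V
  ρ :=
    { toFun h := Sigma.desc fun g => X.ρ h ≫ Sigma.ι (fun _ : G => X.V) (h * g)
      map_one' := Sigma.hom_ext _ _ fun g => by
        rw [Sigma.ι_desc, map_one, one_mul]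
        exact (Category.id_comp _).trans (Category.comp_id _).symm
      map_mul' h k := Sigma.hom_ext _ _ fun g => by
        rw [Sigma.ι_desc, End.mul_def, Sigma.ι_desc_assoc, Category.assoc, Sigma.ι_desc,
          map_mul, End.mul_def, mul_assoc, Category.assoc] }

theorem torsorProj_comm {G : Type v} [Group G] [Finite G] (X : Action Scheme.{u} G) (h : G) :
    (Sigma.desc fun g => X.ρ h ≫ Sigma.ι (fun _ : G => X.V) (h * g)) ≫
      (Sigma.desc fun _ => 𝟙 X.V) = (Sigma.desc fun _ : G => 𝟙 X.V) ≫ X.ρ h :=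
  Sigma.hom_ext _ _ fun g => by
    rw [Sigma.ι_desc_assoc, Category.assoc, Sigma.ι_desc, Sigma.ι_desc_assoc, Category.id_comp]
    exact Category.comp_id _

/-- The second projection `G × X ⟶ X`, a `G`-equivariant finite étale covering of `X`.
As a covering of `[X/G]`, it is the `G`-torsor `X ⟶ [X/G]`. -/
def torsor {G : Type v} [Group G] [Finite G] (X : Action Scheme.{u} G) : EquivariantFEt X :=
  MorphismProperty.Over.mk ⊤
    (A := torsorAction X)
    { hom := Sigma.desc fun _ => 𝟙 X.V
      comm := torsorProj_comm X }
    (finiteEtale_sigmaDesc_id X.V)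

/-- The point `(g, x)` of the fibre of `G × X ⟶ X` above the geometric point `x`. -/
def torsorPoint {G : Type v} [Group G] [Finite G] (X : Action Scheme.{u} G)
    {Ω : Type u} [Field Ω] (x : Spec (.of Ω) ⟶ X.V) (g : G) :
    (quotientFibreFunctor X x).obj (torsor X) :=
  (⟨x ≫ Sigma.ι (fun _ : G => X.V) g, by
    rw [Category.assoc, Sigma.ι_desc, Category.comp_id]⟩ :
    GeomFibre (Sigma.desc fun _ : G => 𝟙 X.V) x)

end

end QuotientStack

namespace QuotientStack

noncomputable section

/-! Forgetting the action has a left adjoint, induction: `Y` goes to `Ind Y = ∐_{g ∈ G} Y`, mapped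
to `X` on the summand `g` by `Y ⟶ X` followed by `g`. The unit embeds the fibre of `Y` into that of
`Ind Y`, as the part above the point `(1, x)` of the torsor `G × X`. Hence an automorphism of `F_x`
is determined by its image in the fundamental group of `[X/G]` (injectivity of `i`). An automorphism
`γ` fixing `(1, x)` preserves this part, so it restricts to an automorphism of `F_x` (exactness in
the middle: `exists_inducedUnit_eq`, `exists_projectionPi1_eq`).

The map `p` exists because `γ` commutes with right multiplications on `G × X`, so it acts by a left
multiplication (`app_torsorPoint`).

Surjectivity of `p` uses a path from `x` to `g⁻¹x`, that is, an isomorphism of fibre functors,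
followed by translation by `g`. Paths come from compactness (`nonempty_fibreFunctor_hom`) and from
the injectivity of every natural transformation between fibre functors
(`fibreFunctor_app_injective`). -/

/-! ### Stability properties of finite étale morphisms -/

instance : finiteEtale.{u}.IsMultiplicative where
  id_mem _ := ⟨inferInstance, inferInstance⟩
  comp_mem f g hf hg := by
    obtain ⟨_, _⟩ := hf
    obtain ⟨_, _⟩ := hg
    exact ⟨inferInstance, inferInstance⟩

instance : finiteEtale.{u}.IsStableUnderBaseChange where
  of_isPullback sq h :=
    ⟨MorphismProperty.of_isPullback (P := @IsFinite) sq h.1,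
      MorphismProperty.of_isPullback (P := @Etale) sq h.2⟩

/-- Morphisms between coverings are thus finite étale, so fibre products of coverings are coverings.
-/
instance : finiteEtale.{u}.HasOfPostcompProperty finiteEtale.{u} where
  of_postcomp f g hg hfg := by
    obtain ⟨_, _⟩ := hg
    obtain ⟨_, _⟩ := hfg
    exact ⟨MorphismProperty.of_postcomp @IsFinite (W' := @IsSeparated) f g inferInstance ‹_›,
      Etale.of_comp f g⟩

/-- Finite étale coverings of a connected scheme are surjective unless they are empty. -/
theorem surjective_of_finiteEtale {X Y : Scheme.{u}} [ConnectedSpace X] [Nonempty Y]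
    (f : Y ⟶ X) (hf : finiteEtale f) : Function.Surjective f := by
  obtain ⟨_, _⟩ := hf
  rw [← Set.range_eq_univ]
  exact IsClopen.eq_univ ⟨f.isClosedMap.isClosed_range, f.isOpenMap.isOpen_range⟩
    (Set.range_nonempty _)

/-- Surjectivity gives a point of `Y` above the image of `x`; its residue extension is separable, so
it embeds in the separably closed field `Ω`. -/
theorem nonempty_geomFibre {X Y : Scheme.{u}} [ConnectedSpace X] [Nonempty Y]
    (f : Y ⟶ X) (hf : finiteEtale f) {Ω : Type u} [Field Ω] [IsSepClosed Ω]
    (x : Spec (.of Ω) ⟶ X) : Nonempty (GeomFibre f x) := by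
  obtain ⟨y, hy⟩ := surjective_of_finiteEtale f hf (x default)
  have := hf.2
  obtain ⟨l, hl, -⟩ := Scheme.exists_fac_of_etale_of_isSepClosed f x y hy
  exact ⟨⟨l, hl⟩⟩

/-! ### Paths: isomorphisms between fibre functors -/

section

variable {X : Scheme.{u}} {Ω : Type u} [Field Ω]

/-- The fibre functor as a corepresentable functor on the category of schemes over `X`. -/
def fibreType (x : Spec (.of Ω) ⟶ X) : FEt X ⥤ Type u :=
  MorphismProperty.Over.forget finiteEtale ⊤ X ⋙ coyoneda.obj (.op (Over.mk x))

/-- Finite limits of coverings are computed over `X`, and a corepresentable functor preserves them.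
-/
instance (x : Spec (.of Ω) ⟶ X) : IsCofiltered (fibreType x).Elements :=
  have : PreservesFiniteLimits (fibreType x) := by
    unfold fibreType; infer_instance
  Functor.isCofiltered_elements _

/-- By the Yoneda principle, a natural transformation `F_x ⟶ F_{x'}` is a compatible family of
points of `F_{x'}(Y)` indexed by the pairs `(Y, y)` with `y ∈ F_x(Y)`. The index category is
cofiltered and the sets are finite and nonempty, so a compatible family exists. -/
theorem nonempty_fibreFunctor_hom [ConnectedSpace X] [IsSepClosed Ω]
    (x x' : Spec (.of Ω) ⟶ X) : Nonempty (fibreFunctor x ⟶ fibreFunctor x') := by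
  let F : (fibreType x).Elements ⥤ Type u :=
    CategoryOfElements.π _ ⋙ fibreFunctor x' ⋙ FintypeCat.incl
  have h₁ (j) : Finite (F.obj j) :=
    inferInstanceAs (Finite ((fibreFunctor x').obj j.1))
  have h₂ (j) : Nonempty (F.obj j) := by
    have : Nonempty j.1.left :=
      ⟨(show Spec (.of Ω) ⟶ j.1.left from (show Over.mk x ⟶ j.1.toComma from j.2).left) default⟩
    exact nonempty_geomFibre (X := X) (Y := j.1.left) j.1.hom j.1.prop x'
  obtain ⟨s, hs⟩ := nonempty_sections_of_finite_cofiltered_system F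
  let a (Y : FEt X) (y : (fibreFunctor x).obj Y) : (fibreType x).Elements :=
    ⟨Y, (Over.homMk y.1 y.2 : Over.mk x ⟶ Y.toComma)⟩
  refine ⟨{ app Y := FintypeCat.homMk fun y => s (a Y y), naturality := fun Y Z f => ?_ }⟩
  refine FintypeCat.hom_ext _ _ fun y => ?_
  -- Compatibility of the family along this morphism of pairs is naturality at `y`.
  let g : a Y y ⟶ a Z ((fibreFunctor x).map f y) := CategoryOfElements.homMk _ _ f (by
    apply Over.OverMorphism.ext
    rfl)
  exact (hs g).symm

/-- Distinct points of a geometric fibre are separated by the complement of the diagonal in the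
self-product of the covering, which is again a finite étale covering. -/
theorem fibreFunctor_app_injective {x x' : Spec (.of Ω) ⟶ X}
    (η : fibreFunctor x ⟶ fibreFunctor x') (Y : FEt X) : Function.Injective (η.app Y) := by
  intro a b hab
  by_contra hne
  let f : Y.left ⟶ X := Y.hom
  have : IsFinite f := Y.prop.1
  have : Etale f := Y.prop.2
  -- The diagonal is closed since `f` is separated, and open since `f` is unramified; its complement
  -- is therefore a clopen part of the fibre product, finite étale over `X`.
  let D : (pullback f f).Opens :=
    ⟨(Set.range (pullback.diagonal f))ᶜ,
      (pullback.diagonal f).isClosedMap.isClosed_range.isOpen_compl⟩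
  have hD : IsClosed (D : Set ↥(pullback f f)) :=
    (pullback.diagonal f).isOpenMap.isOpen_range.isClosed_compl
  have : IsClosedImmersion D.ι := .of_isPreimmersion _ (by simpa using hD)
  let Z : FEt X := MorphismProperty.Over.mk ⊤ (D.ι ≫ pullback.fst f f ≫ f)
    ⟨inferInstance, inferInstance⟩
  let p₁ : Z ⟶ Y := MorphismProperty.Over.homMk (D.ι ≫ pullback.fst f f)
    (Category.assoc _ _ _)
  let p₂ : Z ⟶ Y := MorphismProperty.Over.homMk (D.ι ≫ pullback.snd f f)
    ((Category.assoc _ _ _).trans (congrArg (D.ι ≫ ·) pullback.condition.symm))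
  let t : Spec (.of Ω) ⟶ pullback f f := pullback.lift a.1 b.1 (a.2.trans b.2.symm)
  -- `Spec Ω` has one point: if `t = (a, b)` met the open diagonal, it would factor through it,
  -- giving `a = b`.
  have ht : Set.range t ⊆ Set.range D.ι := by
    rintro _ ⟨w, rfl⟩
    rw [Scheme.Opens.range_ι]
    intro hw
    have hw' : Set.range t ⊆ Set.range (pullback.diagonal f) := by
      rintro _ ⟨w', rfl⟩
      rwa [Subsingleton.elim w' w]
    have h := IsOpenImmersion.lift_fac (pullback.diagonal f) t hw'
    refine hne (Subtype.ext ?_)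
    have h1 := congrArg (fun q => q ≫ pullback.fst f f) h
    have h2 := congrArg (fun q => q ≫ pullback.snd f f) h
    simp only [Category.assoc, pullback.diagonal_fst, pullback.diagonal_snd, t,
      pullback.lift_fst, pullback.lift_snd] at h1 h2
    exact h1.symm.trans h2
  let l : Spec (.of Ω) ⟶ D := IsOpenImmersion.lift D.ι t ht
  have hl : l ≫ D.ι = t := IsOpenImmersion.lift_fac _ _ _
  have hl₁ : l ≫ D.ι ≫ pullback.fst f f = a.1 := by
    rw [← Category.assoc, hl, pullback.lift_fst]
  have hl₂ : l ≫ D.ι ≫ pullback.snd f f = b.1 := by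
    rw [← Category.assoc, hl, pullback.lift_snd]
  let d : (fibreFunctor x).obj Z :=
    (⟨l, by rw [← Category.assoc, ← Category.assoc, Category.assoc l, hl₁]; exact a.2⟩ :
      GeomFibre (D.ι ≫ pullback.fst f f ≫ f) x)
  have hd₁ : (fibreFunctor x).map p₁ d = a := Subtype.ext hl₁
  have hd₂ : (fibreFunctor x).map p₂ d = b := Subtype.ext hl₂
  have e₁ : (fibreFunctor x').map p₁ (η.app Z d) = η.app Y a := by
    rw [← hd₁]; exact (ConcreteCategory.congr_hom (η.naturality p₁) d).symm
  have e₂ : (fibreFunctor x').map p₂ (η.app Z d) = η.app Y b := by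
    rw [← hd₂]; exact (ConcreteCategory.congr_hom (η.naturality p₂) d).symm
  -- The image of `(a, b)` has the coordinates `η a = η b`, so it lies on the diagonal, although `Z`
  -- avoids it.
  let e : Spec (.of Ω) ⟶ D := (η.app Z d).1
  have h12 : e ≫ D.ι ≫ pullback.fst f f = e ≫ D.ι ≫ pullback.snd f f :=
    congrArg Subtype.val (e₁.trans (hab.trans e₂.symm))
  have hfac : e ≫ D.ι = (e ≫ D.ι ≫ pullback.fst f f) ≫ pullback.diagonal f := by
    apply pullback.hom_ext
    · simp
    · simpa using h12.symm
  have hmem : (e ≫ D.ι) default ∈ D := (e default).2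
  rw [hfac] at hmem
  exact hmem ⟨_, rfl⟩

/-- Any two fibre functors of a connected scheme are isomorphic. -/
theorem nonempty_fibreFunctor_iso [ConnectedSpace X] [IsSepClosed Ω]
    (x x' : Spec (.of Ω) ⟶ X) : Nonempty (fibreFunctor x ≅ fibreFunctor x') := by
  obtain ⟨η⟩ := nonempty_fibreFunctor_hom x x'
  obtain ⟨θ⟩ := nonempty_fibreFunctor_hom x' x
  have (Y : FEt X) : IsIso (η.app Y) := by
    rw [ConcreteCategory.isIso_iff_bijective]
    -- `η` and `θ` are injections in opposite directions between finite sets.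
    exact (fibreFunctor_app_injective η Y).bijective_of_nat_card_le
      (Nat.card_le_card_of_injective _ (fibreFunctor_app_injective θ Y))
  have : IsIso η := NatIso.isIso_of_isIso_app η
  exact ⟨asIso η⟩

end

/-! ### Finite disjoint unions of finite étale coverings -/

/-- Unlike étaleness, finiteness is not local on the source, whence an induction that splits off one
summand at a time. -/
theorem isFinite_sigmaDesc {ι : Type v} [Finite ι] {Y X : Scheme.{u}} :
    ∀ [HasCoproduct fun _ : ι => Y] (f : ι → (Y ⟶ X)), (∀ i, IsFinite (f i)) →
      IsFinite (Sigma.desc f) := by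
  induction ι using Finite.induction_empty_option with
  | @of_equiv α β e ih =>
    intro _ f hf
    have : HasCoproduct fun _ : α => Y := hasCoproduct_of_equiv_of_iso (fun _ : β => Y) _ e
      fun _ => Iso.refl _
    let r : (∐ fun _ : β => Y) ≅ ∐ fun _ : α => Y :=
      { hom := Sigma.desc fun b => Sigma.ι (fun _ : α => Y) (e.symm b)
        inv := Sigma.desc fun a => Sigma.ι (fun _ : β => Y) (e a)
        hom_inv_id := Sigma.hom_ext _ _ fun b => by
          rw [Sigma.ι_desc_assoc, Sigma.ι_desc, Category.comp_id, e.apply_symm_apply]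
        inv_hom_id := Sigma.hom_ext _ _ fun a => by
          rw [Sigma.ι_desc_assoc, Sigma.ι_desc, Category.comp_id, e.symm_apply_apply] }
    have h : Sigma.desc f = r.hom ≫ Sigma.desc (fun a => f (e a)) :=
      Sigma.hom_ext _ _ fun b => by
        rw [Sigma.ι_desc, Sigma.ι_desc_assoc, Sigma.ι_desc, e.apply_symm_apply]
    rw [h]
    exact MorphismProperty.comp_mem @IsFinite _ _ (isFinite_of_iso r) (ih _ fun a => hf (e a))
  | h_empty =>
    intro _ f hf
    have : IsEmpty ↥(∐ fun _ : PEmpty => Y) := isInitial_iff_isEmpty.1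
      ⟨IsInitial.ofUniqueHom (fun _ => Sigma.desc fun a => a.elim)
        fun _ _ => Sigma.hom_ext _ _ fun a => a.elim⟩
    infer_instance
  | @h_option α _ ih =>
    intro _ f hf
    let r : (∐ fun _ : Option α => Y) ≅ Y ⨿ (∐ fun _ : α => Y) :=
      { hom := Sigma.desc fun b => b.elim coprod.inl
          (fun a => Sigma.ι (fun _ : α => Y) a ≫ coprod.inr)
        inv := coprod.desc (Sigma.ι (fun _ : Option α => Y) none)
          (Sigma.desc fun a => Sigma.ι (fun _ : Option α => Y) (some a))
        hom_inv_id := Sigma.hom_ext _ _ fun b => by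
          rw [Sigma.ι_desc_assoc, Category.comp_id]
          cases b with
          | none => exact coprod.inl_desc _ _
          | some a =>
            rw [Option.elim_some, Category.assoc, coprod.inr_desc, Sigma.ι_desc]
        inv_hom_id := by
          apply coprod.hom_ext
          · rw [coprod.inl_desc_assoc, Sigma.ι_desc, Category.comp_id, Option.elim_none]
          · refine Sigma.hom_ext _ _ fun a => ?_
            rw [coprod.inr_desc_assoc, Sigma.ι_desc_assoc, Sigma.ι_desc, Category.comp_id,
              Option.elim_some] }
    have h : Sigma.desc f =
        r.hom ≫ coprod.desc (f none) (Sigma.desc (fun a : α => f (some a))) :=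
      Sigma.hom_ext _ _ fun b => by
        rw [Sigma.ι_desc, Sigma.ι_desc_assoc]
        cases b with
        | none => exact (coprod.inl_desc _ _).symm
        | some a => rw [Option.elim_some, Category.assoc, coprod.inr_desc, Sigma.ι_desc]
    rw [h]
    have h1 : IsFinite (Sigma.desc fun a : α => f (some a)) := ih _ fun a => hf (some a)
    have h2 : IsFinite (f none) := hf none
    have h3 : IsFinite (coprod.desc (f none) (Sigma.desc fun a : α => f (some a))) :=
      inferInstance
    exact MorphismProperty.comp_mem @IsFinite _ _ (isFinite_of_iso r) h3

theorem finiteEtale_sigmaDesc {ι : Type v} [Finite ι] {Y X : Scheme.{u}}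
    (f : ι → (Y ⟶ X)) (hf : ∀ i, finiteEtale (f i)) : finiteEtale (Sigma.desc f) :=
  have : IsZariskiLocalAtSource @Etale.{u} :=
    HasRingHomProperty.instIsZariskiLocalAtSource (Q := RingHom.Etale)
  ⟨isFinite_sigmaDesc f fun i => (hf i).1,
    IsZariskiLocalAtSource.sigmaDesc (P := @Etale.{u}) fun i => (hf i).2⟩

/-! ### Induced equivariant coverings -/

section

variable {G : Type v} [Group G]

theorem ρ_mul_comp (X : Action Scheme.{u} G) (g h : G) : X.ρ (g * h) = X.ρ h ≫ X.ρ g :=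
  map_mul X.ρ g h

theorem ρ_inv_comp_ρ (X : Action Scheme.{u} G) (g : G) : X.ρ g⁻¹ ≫ X.ρ g = 𝟙 X.V := by
  rw [← ρ_mul_comp, mul_inv_cancel, map_one]
  rfl

theorem ρ_comp_ρ_inv (X : Action Scheme.{u} G) (g : G) : X.ρ g ≫ X.ρ g⁻¹ = 𝟙 X.V := by
  rw [← ρ_mul_comp, inv_mul_cancel, map_one]
  rfl

theorem finiteEtale_ρ (X : Action Scheme.{u} G) (g : G) : finiteEtale (X.ρ g) := by
  have : IsIso (X.ρ g) := ⟨X.ρ g⁻¹, ρ_comp_ρ_inv X g, ρ_inv_comp_ρ X g⟩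
  exact ⟨inferInstance, inferInstance⟩

variable [Finite G]

/-- The scheme `∐_{g ∈ G} Y` with the action of `G` permuting the summands by left
multiplication. -/
def inducedAction (G : Type v) [Group G] [Finite G] (Y : Scheme.{u}) : Action Scheme.{u} G where
  V := ∐ fun _ : G => Y
  ρ :=
    { toFun h := Sigma.desc fun g => Sigma.ι (fun _ : G => Y) (h * g)
      map_one' := Sigma.hom_ext _ _ fun g => by
        rw [Sigma.ι_desc, one_mul]
        exact (Category.comp_id _).symm
      map_mul' h k := Sigma.hom_ext _ _ fun g => by
        rw [Sigma.ι_desc, End.mul_def, Sigma.ι_desc_assoc, Sigma.ι_desc, mul_assoc] }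

/-- The inclusion of a summand of `∐_{g ∈ G} Y`. -/
def inducedι (Y : Scheme.{u}) (g : G) : Y ⟶ (inducedAction G Y).V :=
  Sigma.ι (fun _ : G => Y) g

theorem inducedι_ρ (Y : Scheme.{u}) (h g : G) :
    inducedι Y g ≫ (inducedAction G Y).ρ h = inducedι Y (h * g) :=
  Sigma.ι_desc _ _

theorem inducedι_hom_ext {Y Z : Scheme.{u}} {a b : (inducedAction G Y).V ⟶ Z}
    (h : ∀ g, inducedι Y g ≫ a = inducedι Y g ≫ b) : a = b :=
  Sigma.hom_ext _ _ h

/-- The morphism from the induced scheme `∐_{g ∈ G} Y` to a scheme with an action of `G` that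
extends `f` on the summand of index `1`. -/
def inducedDescHom {Y : Scheme.{u}} {Z : Action Scheme.{u} G} (f : Y ⟶ Z.V) :
    (inducedAction G Y).V ⟶ Z.V :=
  Sigma.desc fun g => f ≫ Z.ρ g

theorem inducedι_descHom {Y : Scheme.{u}} {Z : Action Scheme.{u} G} (f : Y ⟶ Z.V) (g : G) :
    inducedι Y g ≫ inducedDescHom f = f ≫ Z.ρ g :=
  Sigma.ι_desc _ _

/-- `inducedDescHom` as an equivariant morphism. -/
def inducedDesc {Y : Scheme.{u}} {Z : Action Scheme.{u} G} (f : Y ⟶ Z.V) :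
    inducedAction G Y ⟶ Z where
  hom := inducedDescHom f
  comm h := inducedι_hom_ext fun g => by
    rw [← Category.assoc, inducedι_ρ, inducedι_descHom, ← Category.assoc, inducedι_descHom,
      ρ_mul_comp, Category.assoc]

theorem inducedι_one_desc {Y : Scheme.{u}} {Z : Action Scheme.{u} G} (f : Y ⟶ Z.V) :
    inducedι Y 1 ≫ (inducedDesc f).hom = f := by
  refine (inducedι_descHom f 1).trans ?_
  rw [map_one]
  exact Category.comp_id _

/-- The translates of the summand of index `1` exhaust the induced scheme. -/
theorem inducedAction_hom_ext {Y : Scheme.{u}} {Z : Action Scheme.{u} G}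
    {a b : inducedAction G Y ⟶ Z}
    (h : inducedι Y 1 ≫ a.hom = inducedι Y 1 ≫ b.hom) : a = b := by
  refine Action.Hom.ext (inducedι_hom_ext fun g => ?_)
  have key (c : inducedAction G Y ⟶ Z) : inducedι Y g ≫ c.hom =
      (inducedι Y 1 ≫ c.hom) ≫ Z.ρ g := by
    rw [Category.assoc, ← c.comm, ← Category.assoc, inducedι_ρ, mul_one]
  rw [key a, key b, h]

variable (X : Action Scheme.{u} G)

/-- The equivariant covering of `X` induced from a covering `Y` of the underlying scheme. In terms
of stacks: the composite `Y ⟶ X ⟶ [X/G]`. -/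
def inducedCovering (Y : FEt X.V) : EquivariantFEt X :=
  MorphismProperty.Over.mk ⊤ (A := inducedAction G Y.left)
    (inducedDesc Y.hom)
    (finiteEtale_sigmaDesc _ fun g =>
      finiteEtale.comp_mem _ _ Y.prop (finiteEtale_ρ X g))

variable {X}

/-- The inclusion of a covering in its induced covering. -/
def inducedUnit (Y : FEt X.V) : Y ⟶ (forgetAction X).obj (inducedCovering X Y) :=
  MorphismProperty.Over.homMk (inducedι Y.left 1) (inducedι_one_desc _)

/-- The equivariant morphism of coverings extending a morphism of coverings. -/
def inducedLift {Y : FEt X.V} {Z : EquivariantFEt X} (f : Y ⟶ (forgetAction X).obj Z) :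
    inducedCovering X Y ⟶ Z :=
  MorphismProperty.Over.homMk (inducedDesc f.left)
    (inducedAction_hom_ext
      ((congrArg (· ≫ Z.hom.hom) (inducedι_one_desc (Z := Z.left) f.left)).trans
        ((MorphismProperty.Over.w f).trans (inducedι_one_desc (Z := X) Y.hom).symm)))

theorem inducedUnit_lift {Y : FEt X.V} {Z : EquivariantFEt X} (f : Y ⟶ (forgetAction X).obj Z) :
    inducedUnit Y ≫ (forgetAction X).map (inducedLift f) = f :=
  MorphismProperty.Over.Hom.ext (inducedι_one_desc _)

end

/-! ### Geometric points of disjoint unions -/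

section

variable {G : Type v} [Finite G] {Y : Scheme.{u}} {Ω : Type u} [Field Ω]

theorem exists_factor_sigma (z : Spec (.of Ω) ⟶ ∐ fun _ : G => Y) :
    ∃ (g : G) (l : Spec (.of Ω) ⟶ Y), l ≫ Sigma.ι (fun _ : G => Y) g = z := by
  obtain ⟨g, w, hw⟩ := (sigmaOpenCover fun _ : G => Y).exists_eq (z default)
  have hr : Set.range z ⊆ Set.range (Sigma.ι (fun _ : G => Y) g) := by
    rintro _ ⟨t, rfl⟩
    rw [Subsingleton.elim t default]
    exact ⟨w, hw⟩
  exact ⟨g, IsOpenImmersion.lift _ z hr, IsOpenImmersion.lift_fac _ _ _⟩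

theorem index_eq_of_comp_sigmaι_eq {g h : G} {a b : Spec (.of Ω) ⟶ Y}
    (e : a ≫ Sigma.ι (fun _ : G => Y) g = b ≫ Sigma.ι (fun _ : G => Y) h) : g = h := by
  have e' := congrArg (fun f : Spec (.of Ω) ⟶ ∐ fun _ : G => Y => f default) e
  simp only [Scheme.Hom.comp_apply] at e'
  exact congrArg Sigma.fst ((sigmaι_eq_iff _ _ _ _ _).1 e')

end

/-! ### Continuity of `i` and transport of fibres by the group -/

variable {G : Type v} [Group G] {X : Action Scheme.{u} G} {Ω : Type u} [Field Ω]
  {x : Spec (.of Ω) ⟶ X.V}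

/-- Automorphisms of the fibre functor are compatible with morphisms of equivariant coverings. -/
theorem quotientPi1_naturality
    (γ : quotientPi1 X x) {Y Z : EquivariantFEt X} (f : Y ⟶ Z)
    (y : (quotientFibreFunctor X x).obj Y) :
    γ.hom.app Z ((quotientFibreFunctor X x).map f y) =
      (quotientFibreFunctor X x).map f (γ.hom.app Y y) :=
  ConcreteCategory.congr_hom (γ.hom.naturality f) y

variable (X) (x)

theorem continuous_projectionPi1 : Continuous (projectionPi1 X x) := by
  open PreGaloisCategory in
  refine continuous_induced_rng.2 (continuous_pi fun Y => ?_)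
  exact (continuous_apply ((forgetAction X).obj Y)).comp
    (continuous_induced_dom (f := autEmbedding (fibreFunctor x)))

theorem comp_ρ_hom (Y : EquivariantFEt X) (g : G) :
    Y.left.ρ g ≫ Y.hom.hom = Y.hom.hom ≫ X.ρ g :=
  Y.hom.comm g

/-- Transport of the fibre of an equivariant covering by an element of the group. -/
def fibreTranslate {y z : Spec (.of Ω) ⟶ X.V} (g : G) (h : y ≫ X.ρ g = z) :
    quotientFibreFunctor X y ⟶ quotientFibreFunctor X z where
  app Y := FintypeCat.homMk fun a : GeomFibre Y.hom.hom y =>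
    (⟨a.1 ≫ Y.left.ρ g, (Category.assoc _ _ _).trans ((congrArg (a.1 ≫ ·)
      (comp_ρ_hom X Y g)).trans ((Category.assoc _ _ _).symm.trans
        ((congrArg (· ≫ X.ρ g) a.2).trans h)))⟩ : GeomFibre Y.hom.hom z)
  naturality _ _ f := FintypeCat.hom_ext _ _ fun a => Subtype.ext
    ((Category.assoc _ _ _).trans ((congrArg (a.1 ≫ ·) (f.left.comm g).symm).trans
      (Category.assoc _ _ _).symm))

theorem isIso_fibreTranslate {y z : Spec (.of Ω) ⟶ X.V} (g : G) (h : y ≫ X.ρ g = z) :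
    IsIso (fibreTranslate X g h) := by
  have (Y : EquivariantFEt X) : IsIso ((fibreTranslate X g h).app Y) := by
    have h' : z ≫ X.ρ g⁻¹ = y := by
      rw [← h, Category.assoc, ρ_comp_ρ_inv, Category.comp_id]
    refine ⟨(fibreTranslate X g⁻¹ h').app Y, ?_, ?_⟩
    · exact FintypeCat.hom_ext _ _ fun a => Subtype.ext ((Category.assoc _ _ _).trans
        ((congrArg (a.1 ≫ ·) (ρ_comp_ρ_inv Y.left g)).trans (Category.comp_id _)))
    · exact FintypeCat.hom_ext _ _ fun a => Subtype.ext ((Category.assoc _ _ _).trans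
        ((congrArg (a.1 ≫ ·) (ρ_inv_comp_ρ Y.left g)).trans (Category.comp_id _)))
  exact NatIso.isIso_of_isIso_app _

/-! ### The torsor and the homomorphism to `G` -/

variable [Finite G]

theorem torsorPoint_bijective : Function.Bijective (torsorPoint X x) := by
  refine ⟨fun g h e => index_eq_of_comp_sigmaι_eq (congrArg Subtype.val e), fun z => ?_⟩
  obtain ⟨g, l, hl⟩ := exists_factor_sigma (G := G) (Y := X.V) z.1
  refine ⟨g, Subtype.ext (Eq.trans ?_ hl)⟩
  have hx : l ≫ Sigma.ι (fun _ : G => X.V) g ≫ Sigma.desc (fun _ : G => 𝟙 X.V) = x := by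
    rw [← Category.assoc, hl]
    exact z.2
  rw [Sigma.ι_desc, Category.comp_id] at hx
  rw [hx]
  rfl

/-- The inclusion of a summand of `G × X = ∐_{g ∈ G} X`. -/
def torsorι (g : G) : X.V ⟶ (torsorAction X).V :=
  Sigma.ι (fun _ : G => X.V) g

/-- The projection `G × X ⟶ X` as a morphism of schemes. -/
def torsorProj : (torsorAction X).V ⟶ X.V :=
  Sigma.desc fun _ : G => 𝟙 X.V

theorem torsorι_ρ (h g : G) :
    torsorι X g ≫ (torsorAction X).ρ h = X.ρ h ≫ torsorι X (h * g) :=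
  Sigma.ι_desc _ _

theorem torsorι_proj (g : G) : torsorι X g ≫ torsorProj X = 𝟙 X.V :=
  Sigma.ι_desc _ _

theorem torsorι_hom_ext {Z : Scheme.{u}} {a b : (torsorAction X).V ⟶ Z}
    (h : ∀ g, torsorι X g ≫ a = torsorι X g ≫ b) : a = b :=
  Sigma.hom_ext _ _ h

/-- Right multiplication `(g, y) ↦ (g * k, y)` as a morphism of schemes. -/
def torsorMulRightHom (k : G) : (torsorAction X).V ⟶ (torsorAction X).V :=
  Sigma.desc fun g => torsorι X (g * k)

theorem torsorι_mulRightHom (k g : G) :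
    torsorι X g ≫ torsorMulRightHom X k = torsorι X (g * k) :=
  Sigma.ι_desc _ _

theorem torsorMulRightHom_comm (k h : G) :
    (torsorAction X).ρ h ≫ torsorMulRightHom X k =
      torsorMulRightHom X k ≫ (torsorAction X).ρ h :=
  torsorι_hom_ext X fun g => by
    rw [← Category.assoc, torsorι_ρ, ← Category.assoc, torsorι_mulRightHom, torsorι_ρ,
      Category.assoc, torsorι_mulRightHom, mul_assoc]

theorem torsorMulRightHom_proj (k : G) :
    torsorMulRightHom X k ≫ torsorProj X = torsorProj X :=
  torsorι_hom_ext X fun g => by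
    rw [← Category.assoc, torsorι_mulRightHom, torsorι_proj, torsorι_proj]

/-- The automorphism `(g, y) ↦ (g * k, y)` of the equivariant covering `G × X ⟶ X`. -/
def torsorMulRight (k : G) : torsor X ⟶ torsor X :=
  MorphismProperty.Over.homMk (A := torsor X) (B := torsor X)
    ⟨torsorMulRightHom X k, torsorMulRightHom_comm X k⟩
    (Action.Hom.ext (torsorMulRightHom_proj X k))

theorem torsorMulRight_torsorPoint (k g : G) :
    (quotientFibreFunctor X x).map (torsorMulRight X k) (torsorPoint X x g) =
      torsorPoint X x (g * k) :=
  Subtype.ext ((Category.assoc x (torsorι X g) (torsorMulRightHom X k)).trans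
    (congrArg (x ≫ ·) (torsorι_mulRightHom X k g)))

/-- The action of an automorphism of the fibre functor on the fibre of the torsor `G × X ⟶ X`. -/
def torsorIndex (σ : Aut ((quotientFibreFunctor X x).obj (torsor X))) : G :=
  (Equiv.ofBijective _ (torsorPoint_bijective X x)).symm (σ.hom (torsorPoint X x 1))

theorem torsorPoint_torsorIndex (σ : Aut ((quotientFibreFunctor X x).obj (torsor X))) :
    torsorPoint X x (torsorIndex X x σ) = σ.hom (torsorPoint X x 1) :=
  (Equiv.ofBijective _ (torsorPoint_bijective X x)).apply_symm_apply _

/-- Right multiplication by `g` is an automorphism of the covering carrying `(1, x)` to `(g, x)`,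
and `γ` commutes with it. -/
theorem app_torsorPoint (γ : quotientPi1 X x) (g : G) :
    γ.hom.app (torsor X) (torsorPoint X x g) =
      torsorPoint X x (torsorIndex X x (γ.app (torsor X)) * g) := by
  have h := quotientPi1_naturality γ (torsorMulRight X g) (torsorPoint X x 1)
  rw [torsorMulRight_torsorPoint, one_mul] at h
  exact h.trans ((congrArg ((quotientFibreFunctor X x).map (torsorMulRight X g))
    (torsorPoint_torsorIndex X x (γ.app (torsor X))).symm).trans
      (torsorMulRight_torsorPoint X x _ _))

/-- The homomorphism from the fundamental group of `[X/G]` to `G` given by the action on the fibre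
of the torsor `X ⟶ [X/G]`. -/
def pi1ToGroup : quotientPi1 X x →* G :=
  MonoidHom.mk' (fun γ => torsorIndex X x (γ.app (torsor X))) fun γ δ =>
    (torsorPoint_bijective X x).1 ((torsorPoint_torsorIndex X x ((γ * δ).app (torsor X))).trans
      ((congrArg (γ.hom.app (torsor X))
        (torsorPoint_torsorIndex X x (δ.app (torsor X))).symm).trans (app_torsorPoint X x γ _)))

theorem pi1ToGroup_spec (γ : quotientPi1 X x) (g : G) :
    γ.hom.app (torsor X) (torsorPoint X x g) = torsorPoint X x (pi1ToGroup X x γ * g) :=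
  app_torsorPoint X x γ g

theorem continuous_pi1ToGroup [TopologicalSpace G] : Continuous (pi1ToGroup X x) := by
  open PreGaloisCategory in
  have h : Continuous fun γ : quotientPi1 X x =>
      autEmbedding (quotientFibreFunctor X x) γ (torsor X) :=
    (continuous_apply _).comp continuous_induced_dom
  -- The automorphism group of one finite fibre is discrete, so only evaluation at the torsor needs
  -- to be continuous.
  exact (continuous_of_discreteTopology (f := torsorIndex X x)).comp h

/-! ### Injectivity of `i` and exactness in the middle -/

variable {X}

theorem inducedUnit_injective (Y : FEt X.V) :
    Function.Injective ((fibreFunctor x).map (inducedUnit Y)) := by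
  intro a b h
  refine Subtype.ext ?_
  have h' : a.1 ≫ Sigma.ι (fun _ : G => Y.left) 1 = b.1 ≫ Sigma.ι (fun _ : G => Y.left) 1 :=
    congrArg Subtype.val h
  rwa [cancel_mono] at h'

variable (X) in
-- The fibre of `Y` embeds, compatibly with `σ`, in the fibre of its induced covering, on which the
-- image of `σ` acts.
theorem projectionPi1_injective : Function.Injective (projectionPi1 X x) := by
  intro σ τ h
  refine Iso.ext (NatTrans.ext (funext fun Y => FintypeCat.hom_ext _ _ fun y =>
    inducedUnit_injective x Y ?_))
  have key (σ : pi1 x) : (fibreFunctor x).map (inducedUnit Y) (σ.hom.app Y y) =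
      (projectionPi1 X x σ).hom.app (inducedCovering X Y)
        ((fibreFunctor x).map (inducedUnit Y) y) :=
    (ConcreteCategory.congr_hom (σ.hom.naturality (inducedUnit (X := X) Y)) y).symm
  rw [key, key, h]

/-- The morphism `y ↦ (1, f y)` from a covering `f : Y ⟶ X` to `G × X`. -/
def torsorSection (Y : FEt X.V) : Y ⟶ (forgetAction X).obj (torsor X) :=
  MorphismProperty.Over.homMk (A := Y) (B := (forgetAction X).obj (torsor X))
    (Y.hom ≫ torsorι X 1)
    ((Category.assoc Y.hom (torsorι X 1) (torsorProj X)).trans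
      ((congrArg (Y.hom ≫ ·) (torsorι_proj X 1)).trans (Category.comp_id _)))

theorem torsorSection_apply (Y : FEt X.V) (y : (fibreFunctor x).obj Y) :
    (fibreFunctor x).map (torsorSection Y) y = torsorPoint X x 1 :=
  Subtype.ext ((Category.assoc y.1 Y.hom (torsorι X 1)).symm.trans
    (congrArg (· ≫ torsorι X 1) y.2))

theorem inducedLift_torsorSection_apply (Y : FEt X.V) (y : (fibreFunctor x).obj Y) :
    (quotientFibreFunctor X x).map (inducedLift (torsorSection Y))
      ((fibreFunctor x).map (inducedUnit Y) y) = torsorPoint X x 1 := by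
  have h := congrArg (fun f => (fibreFunctor x).map f y) (inducedUnit_lift (torsorSection Y))
  simp only [Functor.map_comp] at h
  exact Eq.trans h (torsorSection_apply x Y y)

/-- The part of the fibre of an induced covering above the point `(1, x)` of the torsor is the fibre
of the original covering. -/
theorem exists_inducedUnit_eq (Y : FEt X.V)
    (z : (quotientFibreFunctor X x).obj (inducedCovering X Y))
    (hz : (quotientFibreFunctor X x).map (inducedLift (torsorSection Y)) z = torsorPoint X x 1) :
    ∃ y : (fibreFunctor x).obj Y, (fibreFunctor x).map (inducedUnit Y) y = z := by
  obtain ⟨g, l, hl⟩ := exists_factor_sigma (G := G) (Y := Y.left) z.1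
  have h1 : (l ≫ inducedι Y.left g) ≫ inducedDescHom (Z := torsorAction X)
      (Y.hom ≫ torsorι X 1) = x ≫ torsorι X 1 :=
    (congrArg (· ≫ inducedDescHom (Z := torsorAction X) (Y.hom ≫ torsorι X 1)) hl).trans
      (congrArg Subtype.val hz)
  rw [Category.assoc, inducedι_descHom, Category.assoc, torsorι_ρ, mul_one,
    ← Category.assoc, ← Category.assoc] at h1
  -- The map to `G × X` preserves the index of the summand, so a point above `(1, x)` lies in the
  -- summand `1`.
  obtain rfl := index_eq_of_comp_sigmaι_eq h1
  have h4 : l ≫ Y.hom = x := by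
    refine Eq.trans ?_ ((congrArg (· ≫ inducedDescHom (Z := X) Y.hom) hl).trans z.2)
    refine Eq.trans ?_ (Category.assoc l (inducedι Y.left 1) (inducedDescHom (Z := X) Y.hom)).symm
    exact congrArg (l ≫ ·) (inducedι_one_desc (Z := X) Y.hom).symm
  exact ⟨(⟨l, h4⟩ : GeomFibre Y.hom x), Subtype.ext hl⟩

/-- An automorphism of the fibre functor of `[X/G]` which acts trivially on the torsor comes from
an automorphism of the fibre functor of `X`. -/
theorem exists_projectionPi1_eq (γ : quotientPi1 X x) (hγ : pi1ToGroup X x γ = 1) :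
    ∃ δ : pi1 x, projectionPi1 X x δ = γ := by
  -- Since `γ` fixes `(1, x)`, it preserves the part of the fibre above it, which is the fibre of
  -- `Y`.
  have hex (Y : FEt X.V) (y : (fibreFunctor x).obj Y) :
      ∃ y' : (fibreFunctor x).obj Y, (fibreFunctor x).map (inducedUnit Y) y' =
        γ.hom.app (inducedCovering X Y) ((fibreFunctor x).map (inducedUnit Y) y) := by
    refine exists_inducedUnit_eq x Y _ ?_
    rw [← quotientPi1_naturality]
    refine (congrArg _ (inducedLift_torsorSection_apply x Y y)).trans ?_
    rw [pi1ToGroup_spec, hγ, one_mul]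
  choose d hd using hex
  have map_unit {Y : FEt X.V} {Z : EquivariantFEt X} (f : Y ⟶ (forgetAction X).obj Z)
      (y : (fibreFunctor x).obj Y) :
      (quotientFibreFunctor X x).map (inducedLift f) ((fibreFunctor x).map (inducedUnit Y) y) =
        (fibreFunctor x).map f y := by
    have h := congrArg (fun f => (fibreFunctor x).map f y) (inducedUnit_lift f)
    simp only [Functor.map_comp] at h
    exact h
  let η : fibreFunctor x ⟶ fibreFunctor x :=
    { app Y := FintypeCat.homMk (d Y)
      naturality Y Z f := by
        refine FintypeCat.hom_ext _ _ fun y => inducedUnit_injective (X := X) x Z ?_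
        refine (hd Z _).trans ?_
        -- The lift of `f ≫ inducedUnit Z` is the equivariant morphism `Ind Y ⟶ Ind Z` induced by
        -- `f`, and `γ` commutes with it.
        have h1 := map_unit (f ≫ inducedUnit Z) y
        have h2 := map_unit (f ≫ inducedUnit Z) (d Y y)
        rw [hd, ← quotientPi1_naturality, h1] at h2
        simp only [Functor.map_comp] at h2
        exact h2 }
  have (Y : FEt X.V) : IsIso (η.app Y) := by
    rw [ConcreteCategory.isIso_iff_bijective]
    exact Finite.injective_iff_bijective.1 (fibreFunctor_app_injective η Y)
  have : IsIso η := NatIso.isIso_of_isIso_app η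
  refine ⟨asIso η, Iso.ext (NatTrans.ext (funext fun Z => FintypeCat.hom_ext _ _ fun z => ?_))⟩
  -- Lifting the identity gives the counit `Ind Z ⟶ Z`; naturality of `γ` along it compares `η` with
  -- `γ` on `Z`.
  have h1 := map_unit (𝟙 ((forgetAction X).obj Z)) z
  have h2 := map_unit (𝟙 ((forgetAction X).obj Z)) (d _ z)
  rw [hd, ← quotientPi1_naturality, h1] at h2
  exact h2.symm

/-! ### The kernel of `p` and its surjectivity -/

variable (X)

/-- Natural transformations of fibre functors are compatible with the trivial torsor. -/
theorem fibreFunctor_hom_torsorPoint {y : Spec (.of Ω) ⟶ X.V}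
    (η : fibreFunctor x ⟶ fibreFunctor y) :
    η.app ((forgetAction X).obj (torsor X)) (torsorPoint X x 1) = torsorPoint X y 1 := by
  -- The points `(1, x)` and `(1, y)` lie on one section of `G × X ⟶ X`, a morphism from the trivial
  -- covering `X₀`.
  let X₀ : FEt X.V := MorphismProperty.Over.mk ⊤ (𝟙 X.V) (finiteEtale.id_mem _)
  let x₀ : (fibreFunctor x).obj X₀ := (⟨x, Category.comp_id _⟩ : GeomFibre (𝟙 X.V) x)
  exact (congrArg _ (torsorSection_apply x X₀ x₀).symm).trans
    ((ConcreteCategory.congr_hom (η.naturality (torsorSection X₀)) x₀).trans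
      (torsorSection_apply y X₀ _))

theorem projectionPi1_mem_ker (δ : pi1 x) : pi1ToGroup X x (projectionPi1 X x δ) = 1 := by
  apply (torsorPoint_bijective X x).1
  rw [← mul_one (pi1ToGroup X x _), ← pi1ToGroup_spec]
  exact fibreFunctor_hom_torsorPoint X x δ.hom

theorem range_projectionPi1 : (projectionPi1 X x).range = (pi1ToGroup X x).ker := by
  refine le_antisymm ?_ fun γ hγ => exists_projectionPi1_eq x γ hγ
  rintro _ ⟨δ, rfl⟩
  exact projectionPi1_mem_ker X x δ

theorem fibreTranslate_torsorPoint {y z : Spec (.of Ω) ⟶ X.V} (g k : G) (h : y ≫ X.ρ g = z) :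
    (fibreTranslate X g h).app (torsor X) (torsorPoint X y k) = torsorPoint X z (g * k) :=
  Subtype.ext ((Category.assoc y (torsorι X k) ((torsorAction X).ρ g)).trans
    ((congrArg (y ≫ ·) (torsorι_ρ X g k)).trans ((Category.assoc _ _ _).symm.trans
      (congrArg (· ≫ torsorι X (g * k)) h))))

theorem pi1ToGroup_surjective [ConnectedSpace X.V] [IsSepClosed Ω] :
    Function.Surjective (pi1ToGroup X x) := by
  intro g
  have hy : (x ≫ X.ρ g⁻¹) ≫ X.ρ g = x := by
    rw [Category.assoc, ρ_inv_comp_ρ, Category.comp_id]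
  -- The path takes `(1, x)` to `(1, g⁻¹x)`, and translation by `g` takes this to `(g, x)`.
  obtain ⟨η⟩ := nonempty_fibreFunctor_iso x (x ≫ X.ρ g⁻¹)
  have := isIso_fibreTranslate X g hy
  let γ : quotientPi1 X x :=
    Functor.isoWhiskerLeft (forgetAction X) η ≪≫ asIso (fibreTranslate X g hy)
  refine ⟨γ, (torsorPoint_bijective X x).1 ?_⟩
  rw [← mul_one (pi1ToGroup X x γ), ← pi1ToGroup_spec, ← mul_one g]
  exact (congrArg _ (fibreFunctor_hom_torsorPoint X x η.hom)).trans
    (fibreTranslate_torsorPoint X g 1 hy)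

end

end QuotientStack

theorem corollary6p4 {G : Type v} [Group G] [Finite G] [TopologicalSpace G] [DiscreteTopology G]
    (X : Action Scheme.{u} G) [ConnectedSpace X.V]
    {Ω : Type u} [Field Ω] [IsSepClosed Ω] (x : Spec (.of Ω) ⟶ X.V) :
    ∃ p : QuotientStack.quotientPi1 X x →* G,
      (∀ (γ : QuotientStack.quotientPi1 X x) (g : G),
        γ.hom.app (QuotientStack.torsor X) (QuotientStack.torsorPoint X x g) =
          QuotientStack.torsorPoint X x (p γ * g)) ∧
      Continuous (QuotientStack.projectionPi1 X x) ∧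
      Continuous p ∧
      Function.Injective (QuotientStack.projectionPi1 X x) ∧
      (QuotientStack.projectionPi1 X x).range = p.ker ∧
      Function.Surjective p :=
  ⟨QuotientStack.pi1ToGroup X x, QuotientStack.pi1ToGroup_spec X x,
    QuotientStack.continuous_projectionPi1 X x, QuotientStack.continuous_pi1ToGroup X x,
    QuotientStack.projectionPi1_injective X x, QuotientStack.range_projectionPi1 X x,
    QuotientStack.pi1ToGroup_surjective X x⟩
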